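/- Let $M$ be a smooth manifold of dimension $2n+p$ with $n\ge 0$ and $p\ge 1$; all tensor fields below are smooth. A metric weak $f$-structure $(f,Q,\xi_i,\eta^i,g)$ on $M$ consists of a $(1,1)$-tensor field $f$ of constant rank $2n$, a nonsingular $(1,1)$-tensor field $Q$, vector fields $\xi_1,\dots,\xi_p$ spanning $\ker f$ at every point, one-forms $\eta^1,\dots,\eta^p$, and a Riemannian metric $g$, such that for all $i,j$ and all vector fields $X,Y$ $$f^3+fQ=0,\qquad Q\xi=\xi\ \ (\xi\in\ker f),\qquad f^2=-Q+\sum_i\eta^i\otimes\xi_i,\qquad \eta^i(\xi_j)=\delta^i_j,$$ $$g(\xi_i,\xi_i)=1,\qquad g(fX,fY)=g(X,QY)-\sum_i\eta^i(X)\,\eta^i(QY).$$ Put $\Phi(X,Y)=g(X,fY)$, $\ d\eta^i(X,Y)=\tfrac12\{X(\eta^i(Y))-Y(\eta^i(X))-\eta^i([X,Y])\}$, and $N^{(1)}=[f,f]+2\sum_i d\eta^i\otimes\xi_i$, where $[f,f](X,Y)=f^2[X,Y]+[fX,fY]-f[fX,Y]-f[X,fY]$. The structure is normal if $N^{(1)}=0$.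 A weak $\mathcal S$-structure is a normal metric weak $f$-structure with $d\eta^i=\Phi$ for all $1\le i\le p$. A (classical) $\mathcal S$-structure $(f,\xi_i,\eta^i,g)$ consists of a $(1,1)$-tensor field $f$ of constant rank $2n$ with $f^3+f=0$, vector fields $\xi_i$ spanning $\ker f$, one-forms $\eta^i$ with $f^2=-\mathrm{id}+\sum_i\eta^i\otimes\xi_i$ and $\eta^i(\xi_j)=\delta^i_j$, and a Riemannian metric $g$ with $g(fX,fY)=g(X,Y)-\sum_i\eta^i(X)\,\eta^i(Y)$, such that $N^{(1)}=0$ and $d\eta^i=\Phi$ for all $i$. **Theorem.** A metric weak $f$-structure $(f,Q,\xi_i,\eta^i,g)$ on $M$ is a weak $\mathcal S$-structure if and only if $Q=\mathrm{id}_{TM}$ and $(f,\xi_i,\eta^i,g)$ is an $\mathcal S$-structure. -/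

import Mathlib

open scoped Manifold ContDiff Bundle

noncomputable section

namespace WeakF

/-- The model space of an `m`-dimensional manifold. -/
abbrev Model (m : ℕ) := EuclideanSpace ℝ (Fin m)

section Tensors

variable (m : ℕ) (M : Type*) [TopologicalSpace M] [ChartedSpace (Model m) M]
  [IsManifold (𝓡 m) ∞ M]

/-- Smooth vector fields on `M`. -/
abbrev VField := Cₛ^∞⟮𝓡 m; Model m, (fun x : M ↦ TangentSpace (𝓡 m) x)⟯

/-- Smooth one-forms on `M`. -/
abbrev OneForm :=
  Cₛ^∞⟮𝓡 m; Model m →L[ℝ] ℝ, (fun x : M ↦ TangentSpace (𝓡 m) x →L[ℝ] ℝ)⟯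

/-- Smooth `(1,1)`-tensor fields on `M`, as fields of endomorphisms of the tangent spaces. -/
abbrev EndField :=
  Cₛ^∞⟮𝓡 m; Model m →L[ℝ] Model m,
    (fun x : M ↦ TangentSpace (𝓡 m) x →L[ℝ] TangentSpace (𝓡 m) x)⟯

/-- Smooth `(0,2)`-tensor fields on `M`, as fields of bilinear forms on the tangent spaces. -/
abbrev BilinField :=
  Cₛ^∞⟮𝓡 m; Model m →L[ℝ] Model m →L[ℝ] ℝ,
    (fun x : M ↦ TangentSpace (𝓡 m) x →L[ℝ] TangentSpace (𝓡 m) x →L[ℝ] ℝ)⟯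

variable {m M}

/-- The derivative `X(φ)` of a function `φ` along a vector field `X`, at the point `x`. -/
def dirDeriv (X : ∀ x : M, TangentSpace (𝓡 m) x) (φ : M → ℝ) (x : M) : ℝ :=
  mfderiv (𝓡 m) 𝓘(ℝ, ℝ) φ x (X x)

/-- The Lie bracket `[X, Y]` of vector fields. -/
abbrev bracket (X Y : ∀ x : M, TangentSpace (𝓡 m) x) : ∀ x : M, TangentSpace (𝓡 m) x :=
  VectorField.mlieBracket (𝓡 m) X Y

/-- The exterior derivative of a one-form, with the normalisation
`dη(X,Y) = (1/2) {X(η(Y)) - Y(η(X)) - η([X,Y])}`. -/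
def dOneForm (η : OneForm m M) (X Y : VField m M) (x : M) : ℝ :=
  (1 / 2 : ℝ) * (dirDeriv X (fun y ↦ η y (Y y)) x - dirDeriv Y (fun y ↦ η y (X y)) x
    - η x (bracket X Y x))

/-- The Nijenhuis torsion
`[f,f](X,Y) = f² [X,Y] + [f X, f Y] - f [f X, Y] - f [X, f Y]`. -/
def nijenhuis (f : EndField m M) (X Y : VField m M) (x : M) : TangentSpace (𝓡 m) x :=
  f x (f x (bracket X Y x)) + bracket (fun y ↦ f y (X y)) (fun y ↦ f y (Y y)) x
    - f x (bracket (fun y ↦ f y (X y)) Y x) - f x (bracket X (fun y ↦ f y (Y y)) x)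

/-- The tensor `N⁽¹⁾ = [f,f] + 2 ∑ᵢ dηⁱ ⊗ ξᵢ`. -/
def normalityTensor {p : ℕ} (f : EndField m M) (ξ : Fin p → VField m M)
    (η : Fin p → OneForm m M) (X Y : VField m M) (x : M) : TangentSpace (𝓡 m) x :=
  nijenhuis f X Y x + (2 : ℝ) • ∑ i, dOneForm (η i) X Y x • ξ i x

/-- Normality: `N⁽¹⁾` is identically zero. -/
def IsNormal {p : ℕ} (f : EndField m M) (ξ : Fin p → VField m M)
    (η : Fin p → OneForm m M) : Prop :=
  ∀ (X Y : VField m M) (x : M), normalityTensor f ξ η X Y x = 0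

/-- The fundamental form `Φ(X,Y) = g(X, f Y)`. -/
def fundamentalForm (f : EndField m M) (g : BilinField m M) (X Y : VField m M) (x : M) : ℝ :=
  g x (X x) (f x (Y x))

/-- A Riemannian metric: a smooth field of positive definite symmetric bilinear forms. -/
structure IsRiemannian (g : BilinField m M) : Prop where
  symm : ∀ (x : M) (v w : TangentSpace (𝓡 m) x), g x v w = g x w v
  pos : ∀ (x : M) (v : TangentSpace (𝓡 m) x), v ≠ 0 → 0 < g x v v

end Tensors

section Structures

variable {n p : ℕ} {M : Type*} [TopologicalSpace M] [ChartedSpace (Model (2 * n + p)) M]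
  [IsManifold (𝓡 (2 * n + p)) ∞ M]

/-- A weak `f`-structure on `M^{2n+p}`: `f` has rank `2n`, `Q` is nonsingular, `f³ + fQ = 0`, and
`Q ξ = ξ` for `ξ ∈ ker f`. -/
structure IsWeakFStructure (f Q : EndField (2 * n + p) M) : Prop where
  rank_eq : ∀ x : M, Module.finrank ℝ (LinearMap.range (f x).toLinearMap) = 2 * n
  nonsingular : ∀ x : M, Function.Bijective (Q x)
  cube : ∀ (x : M) (v : TangentSpace (𝓡 (2 * n + p)) x), f x (f x (f x v)) + f x (Q x v) = 0
  apply_ker : ∀ (x : M) (v : TangentSpace (𝓡 (2 * n + p)) x), f x v = 0 → Q x v = v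

/-- A framed weak `f`-structure: a weak `f`-structure with global vector fields `ξᵢ` spanning
`ker f` and dual one-forms `ηⁱ`, so that `f² = -Q + ∑ᵢ ηⁱ ⊗ ξᵢ` and `ηⁱ(ξⱼ) = δⁱⱼ`. -/
structure IsFramedWeakFStructure (f Q : EndField (2 * n + p) M)
    (ξ : Fin p → VField (2 * n + p) M) (η : Fin p → OneForm (2 * n + p) M) : Prop
    extends IsWeakFStructure f Q where
  mem_ker_iff : ∀ (x : M) (v : TangentSpace (𝓡 (2 * n + p)) x),
    f x v = 0 ↔ v ∈ Submodule.span ℝ (Set.range fun i ↦ ξ i x)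
  dual : ∀ (x : M) (i j : Fin p), η i x (ξ j x) = if i = j then 1 else 0
  sq : ∀ (x : M) (v : TangentSpace (𝓡 (2 * n + p)) x),
    f x (f x v) = -Q x v + ∑ i, η i x v • ξ i x

/-- A metric weak `f`-structure `(f, Q, ξᵢ, ηⁱ, g)`: a framed weak `f`-structure with a compatible
Riemannian metric `g`, i.e. `g(ξᵢ, ξᵢ) = 1` and `g(fX, fY) = g(X, QY) - ∑ᵢ ηⁱ(X) ηⁱ(QY)`. -/
structure IsMetricWeakFStructure (f Q : EndField (2 * n + p) M)
    (ξ : Fin p → VField (2 * n + p) M) (η : Fin p → OneForm (2 * n + p) M)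
    (g : BilinField (2 * n + p) M) : Prop
    extends IsFramedWeakFStructure f Q ξ η where
  riemannian : IsRiemannian g
  unit : ∀ (x : M) (i : Fin p), g x (ξ i x) (ξ i x) = 1
  compatible : ∀ (x : M) (v w : TangentSpace (𝓡 (2 * n + p)) x),
    g x (f x v) (f x w) = g x v (Q x w) - ∑ i, η i x v * η i x (Q x w)

/-- A weak `𝒮`-structure: a normal metric weak `f`-structure with `dηⁱ = Φ` for all `i`. For
`p ≥ 1` the form `Φ` is then automatically closed, being exact. -/
structure IsWeakSStructure (f Q : EndField (2 * n + p) M)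
    (ξ : Fin p → VField (2 * n + p) M) (η : Fin p → OneForm (2 * n + p) M)
    (g : BilinField (2 * n + p) M) : Prop
    extends IsMetricWeakFStructure f Q ξ η g where
  normal : IsNormal f ξ η
  dOneForm_eq : ∀ (i : Fin p) (X Y : VField (2 * n + p) M) (x : M),
    dOneForm (η i) X Y x = fundamentalForm f g X Y x

/-- A classical globally framed metric `f`-structure `(f, ξᵢ, ηⁱ, g)`: `f` has rank `2n` and
`f³ + f = 0`, the `ξᵢ` span `ker f`, `f² = -id + ∑ᵢ ηⁱ ⊗ ξᵢ`, `ηⁱ(ξⱼ) = δⁱⱼ`, and `g` is a Riemannian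
metric with `g(fX, fY) = g(X, Y) - ∑ᵢ ηⁱ(X) ηⁱ(Y)`. -/
structure IsMetricFStructure (f : EndField (2 * n + p) M)
    (ξ : Fin p → VField (2 * n + p) M) (η : Fin p → OneForm (2 * n + p) M)
    (g : BilinField (2 * n + p) M) : Prop where
  rank_eq : ∀ x : M, Module.finrank ℝ (LinearMap.range (f x).toLinearMap) = 2 * n
  cube : ∀ (x : M) (v : TangentSpace (𝓡 (2 * n + p)) x), f x (f x (f x v)) + f x v = 0
  mem_ker_iff : ∀ (x : M) (v : TangentSpace (𝓡 (2 * n + p)) x),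
    f x v = 0 ↔ v ∈ Submodule.span ℝ (Set.range fun i ↦ ξ i x)
  dual : ∀ (x : M) (i j : Fin p), η i x (ξ j x) = if i = j then 1 else 0
  sq : ∀ (x : M) (v : TangentSpace (𝓡 (2 * n + p)) x),
    f x (f x v) = -v + ∑ i, η i x v • ξ i x
  riemannian : IsRiemannian g
  compatible : ∀ (x : M) (v w : TangentSpace (𝓡 (2 * n + p)) x),
    g x (f x v) (f x w) = g x v w - ∑ i, η i x v * η i x w

/-- A classical `𝒮`-structure: a normal metric `f`-structure with `dηⁱ = Φ` for all `i`. -/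
structure IsSStructure (f : EndField (2 * n + p) M)
    (ξ : Fin p → VField (2 * n + p) M) (η : Fin p → OneForm (2 * n + p) M)
    (g : BilinField (2 * n + p) M) : Prop
    extends IsMetricFStructure f ξ η g where
  normal : IsNormal f ξ η
  dOneForm_eq : ∀ (i : Fin p) (X Y : VField (2 * n + p) M) (x : M),
    dOneForm (η i) X Y x = fundamentalForm f g X Y x

end Structures

end WeakF

end

/-!
The equation `dηⁱ = Φ` makes `Φ` alternating, i.e. `f` skew-adjoint for `g`; since `ηⁱ` is
`g`-dual to `ξᵢ ∈ ker f`, it follows that `ηⁱ ∘ f = 0`, so that `ηⁱ` vanishes on the range of `f`.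
Applying `ηʲ` to `N⁽¹⁾(X, Y) = 0` therefore kills every term involving an outer `f` and leaves
`ηʲ([fX, fY]) + 2 dηʲ(X, Y) = 0`. On the other hand `2 dηʲ(fX, fY) = -ηʲ([fX, fY])`, because the
functions `ηʲ(fX)` and `ηʲ(fY)` vanish identically. Hence `Φ(fX, fY) = Φ(X, Y)`
(`IsWeakSStructure.fundamentalForm_apply_apply`). By skew-adjointness and `f³ = -fQ` this reads
`g(X, fQY) = g(X, fY)`, so `fQ = f` and `QY - Y` lies in `ker f`. Finally `ηⁱ ∘ Q = ηⁱ`, and an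
element of `ker f` on which all `ηⁱ` vanish is zero; thus `Q = id`.

The tensor identities are needed at single tangent vectors while the hypotheses are about global
vector fields; a bump function provides a global field through each tangent vector
(`exists_vField_apply_eq`).
-/

namespace WeakF

section Tensors

variable {m : ℕ} {M : Type*} [TopologicalSpace M] [ChartedSpace (Model m) M]
  [IsManifold (𝓡 m) ∞ M]

theorem exists_vField_apply_eq [T2Space M] (x : M) (v : TangentSpace (𝓡 m) x) :
    ∃ X : VField m M, X x = v := by
  obtain ⟨u, hu, hs⟩ := FiberBundle.exists_contMDiffOn_extend (𝓡 m) (Model m) (k := ∞) v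
  obtain ⟨ψ, -, hψ⟩ := (SmoothBumpFunction.nhds_basis_tsupport (I := 𝓡 m) x).mem_iff.1
    (interior_mem_nhds.2 hu)
  refine ⟨⟨(ψ : M → ℝ) • FiberBundle.extend (Model m) v,
    ContMDiffOn.smul_section_of_tsupport ψ.contMDiff.contMDiffOn isOpen_interior hψ
      (hs.mono interior_subset)⟩, ?_⟩
  change ψ x • FiberBundle.extend (Model m) v x = v
  simp

/-- The vector field `fX`. -/
noncomputable def EndField.apply (f : EndField m M) (X : VField m M) : VField m M :=
  ⟨fun y ↦ f y (X y), f.contMDiff.clm_bundle_apply X.contMDiff⟩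

theorem dOneForm_swap (η : OneForm m M) (X Y : VField m M) (x : M) :
    dOneForm η X Y x = -dOneForm η Y X x := by
  have h : bracket X Y x = -bracket Y X x := VectorField.mlieBracket_swap_apply
  simp only [dOneForm, h, map_neg]
  ring

theorem dOneForm_of_apply_eq_zero (η : OneForm m M) (X Y : VField m M)
    (hX : ∀ y, η y (X y) = 0) (hY : ∀ y, η y (Y y) = 0) (x : M) :
    dOneForm η X Y x = -(1 / 2 : ℝ) * η x (bracket X Y x) := by
  have h0 (Z : VField m M) : dirDeriv Z (fun _ : M ↦ (0 : ℝ)) x = 0 := by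
    rw [dirDeriv, mfderiv_const]
    rfl
  simp only [dOneForm, hX, hY, h0]
  ring

end Tensors

section Structures

variable {n p : ℕ} {M : Type*} [TopologicalSpace M] [ChartedSpace (Model (2 * n + p)) M]
  [IsManifold (𝓡 (2 * n + p)) ∞ M] {f Q : EndField (2 * n + p) M}
  {ξ : Fin p → VField (2 * n + p) M} {η : Fin p → OneForm (2 * n + p) M}
  {g : BilinField (2 * n + p) M}

theorem IsFramedWeakFStructure.f_ξ (h : IsFramedWeakFStructure f Q ξ η) (x : M) (i : Fin p) :
    f x (ξ i x) = 0 :=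
  (h.mem_ker_iff x _).2 (Submodule.subset_span ⟨i, rfl⟩)

theorem IsFramedWeakFStructure.η_sum_smul_ξ (h : IsFramedWeakFStructure f Q ξ η) (x : M)
    (i : Fin p) (c : Fin p → ℝ) : η i x (∑ j, c j • ξ j x) = c i := by
  simp [map_sum, h.dual]

/-- The `ηⁱ` separate the vectors of `ker f`. -/
theorem IsFramedWeakFStructure.eq_zero_of_f_eq_zero (h : IsFramedWeakFStructure f Q ξ η) {x : M}
    {v : TangentSpace (𝓡 (2 * n + p)) x} (hf : f x v = 0) (hη : ∀ i, η i x v = 0) : v = 0 := by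
  obtain ⟨c, rfl⟩ := (Submodule.mem_span_range_iff_exists_fun ℝ).1 ((h.mem_ker_iff x v).1 hf)
  refine Finset.sum_eq_zero fun i _ ↦ ?_
  rw [← h.η_sum_smul_ξ x i c, hη i, zero_smul]

theorem IsMetricWeakFStructure.η_eq (h : IsMetricWeakFStructure f Q ξ η g) (x : M) (i : Fin p)
    (v : TangentSpace (𝓡 (2 * n + p)) x) : η i x v = g x v (ξ i x) := by
  have hc := h.compatible x v (ξ i x)
  rw [h.apply_ker x _ (h.f_ξ x i), h.f_ξ x i, map_zero] at hc
  simp only [h.dual, mul_ite, mul_one, mul_zero, Finset.sum_ite_eq', Finset.mem_univ,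
    if_true] at hc
  linarith

namespace IsWeakSStructure

variable [T2Space M]

theorem g_f_swap (h : IsWeakSStructure f Q ξ η g) (hp : 1 ≤ p) (x : M)
    (v w : TangentSpace (𝓡 (2 * n + p)) x) : g x v (f x w) = -g x w (f x v) := by
  obtain ⟨X, rfl⟩ := exists_vField_apply_eq x v
  obtain ⟨Y, rfl⟩ := exists_vField_apply_eq x w
  have h1 := dOneForm_swap (η ⟨0, hp⟩) X Y x
  rwa [h.dOneForm_eq, h.dOneForm_eq] at h1

theorem η_f (h : IsWeakSStructure f Q ξ η g) (x : M) (i : Fin p)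
    (v : TangentSpace (𝓡 (2 * n + p)) x) : η i x (f x v) = 0 := by
  rw [h.η_eq, h.riemannian.symm, h.g_f_swap i.pos, h.f_ξ, map_zero, neg_zero]

theorem η_Q (h : IsWeakSStructure f Q ξ η g) (x : M) (i : Fin p)
    (v : TangentSpace (𝓡 (2 * n + p)) x) : η i x (Q x v) = η i x v := by
  have h1 := congrArg (η i x) (h.sq x v)
  rw [h.η_f, map_add, map_neg, h.η_sum_smul_ξ] at h1
  linarith

/-- The `ξⱼ`-component of normality. -/
theorem η_bracket (h : IsWeakSStructure f Q ξ η g) (j : Fin p) (X Y : VField (2 * n + p) M)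
    (x : M) : η j x (bracket (f.apply X) (f.apply Y) x) = -2 * dOneForm (η j) X Y x := by
  have h1 := congrArg (η j x) (h.normal X Y x)
  simp only [normalityTensor, nijenhuis, map_add, map_sub, map_smul, h.η_f, h.η_sum_smul_ξ,
    map_zero, smul_eq_mul] at h1
  have h2 : η j x (bracket (fun y ↦ f y (X y)) (fun y ↦ f y (Y y)) x) =
    η j x (bracket (f.apply X) (f.apply Y) x) := rfl
  rw [h2] at h1
  linarith

/-- `Φ(fX, fY) = Φ(X, Y)`, obtained by computing `dηʲ(fX, fY)` for any one `j`. -/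
theorem fundamentalForm_apply_apply (h : IsWeakSStructure f Q ξ η g) (hp : 1 ≤ p)
    (X Y : VField (2 * n + p) M) (x : M) :
    fundamentalForm f g (f.apply X) (f.apply Y) x = fundamentalForm f g X Y x := by
  have h1 := dOneForm_of_apply_eq_zero (η ⟨0, hp⟩) (f.apply X) (f.apply Y)
    (fun y ↦ h.η_f y _ _) (fun y ↦ h.η_f y _ _) x
  rw [h.η_bracket, h.dOneForm_eq, h.dOneForm_eq] at h1
  linarith

theorem f_Q (h : IsWeakSStructure f Q ξ η g) (hp : 1 ≤ p) (x : M)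
    (v : TangentSpace (𝓡 (2 * n + p)) x) : f x (Q x v) = f x v := by
  have h1 (u : TangentSpace (𝓡 (2 * n + p)) x) : g x u (f x (Q x v)) = g x u (f x v) := by
    obtain ⟨X, rfl⟩ := exists_vField_apply_eq x u
    obtain ⟨Y, rfl⟩ := exists_vField_apply_eq x v
    have h2 : g x (f x (X x)) (f x (f x (Y x))) = g x (X x) (f x (Y x)) :=
      h.fundamentalForm_apply_apply hp X Y x
    rw [h.riemannian.symm, h.g_f_swap hp, eq_neg_of_add_eq_zero_left (h.cube x (Y x)),
      map_neg, neg_neg] at h2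
    exact h2
  -- `g` is nondegenerate: test `h1` on the difference itself.
  by_contra hne
  have h3 := h.riemannian.pos x _ (sub_ne_zero.2 hne)
  rw [map_sub, h1, sub_self] at h3
  exact h3.false

theorem Q_eq_id (h : IsWeakSStructure f Q ξ η g) (hp : 1 ≤ p) (x : M) :
    Q x = ContinuousLinearMap.id ℝ (TangentSpace (𝓡 (2 * n + p)) x) := by
  ext1 v
  refine sub_eq_zero.1 (h.eq_zero_of_f_eq_zero ?_ fun i ↦ ?_)
  · rw [map_sub, h.f_Q hp]
    exact sub_self _
  · rw [map_sub, h.η_Q]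
    exact sub_self _

theorem isSStructure (h : IsWeakSStructure f Q ξ η g) (hp : 1 ≤ p) : IsSStructure f ξ η g where
  rank_eq := h.rank_eq
  cube x v := by simpa [h.Q_eq_id hp] using h.cube x v
  mem_ker_iff := h.mem_ker_iff
  dual := h.dual
  sq x v := by simpa [h.Q_eq_id hp] using h.sq x v
  riemannian := h.riemannian
  compatible x v w := by simpa [h.Q_eq_id hp] using h.compatible x v w
  normal := h.normal
  dOneForm_eq := h.dOneForm_eq

end IsWeakSStructure

end Structures

end WeakF

theorem mainTheorem1 {n p : ℕ} (hp : 1 ≤ p) {M : Type*} [TopologicalSpace M] [T2Space M]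
    [ChartedSpace (WeakF.Model (2 * n + p)) M] [IsManifold (𝓡 (2 * n + p)) ∞ M]
    (f Q : WeakF.EndField (2 * n + p) M)
    (ξ : Fin p → WeakF.VField (2 * n + p) M) (η : Fin p → WeakF.OneForm (2 * n + p) M)
    (g : WeakF.BilinField (2 * n + p) M)
    (h : WeakF.IsMetricWeakFStructure f Q ξ η g) :
    WeakF.IsWeakSStructure f Q ξ η g ↔
      (∀ x : M, Q x = ContinuousLinearMap.id ℝ (TangentSpace (𝓡 (2 * n + p)) x)) ∧
        WeakF.IsSStructure f ξ η g :=
  ⟨fun hS ↦ ⟨hS.Q_eq_id hp, hS.isSStructure hp⟩,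
    fun hS ↦ ⟨h, hS.2.normal, hS.2.dOneForm_eq⟩⟩
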